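/- Let $K$ be a field of characteristic $0$. An initial commutative dialgebra over $K$ is a vector space $S$ with two bilinear operations $\dashv,\vdash$ such that, for all $a,b,c\in S$, $$a\dashv b=b\vdash a,\qquad a\dashv(b\dashv c)=a\dashv(b\vdash c),\qquad (a\vdash b)\vdash c=(a\dashv b)\vdash c,$$ $$(a\dashv b)\dashv c=a\dashv(b\dashv c),\qquad (a\vdash b)\dashv c=a\vdash(b\dashv c),\qquad (a\vdash b)\vdash c=a\vdash(b\vdash c),$$ $$(a\vdash b)\vdash c=a\dashv(b\dashv c).$$ Let $\mathrm{di}\text{-}\mathrm{Com}^{\mathrm I}$ be the binary quadratic operad of the variety of initial commutative dialgebras. An algebra $U$ with one bilinear product $(u,v)\mapsto uv$ is called Lie-admissible if the commutator $[u,v]=uv-vu$ satisfies the Jacobi identity $[[u,v],w]+[[v,w],u]+[[w,u],v]=0$; let $\mathrm{LieAdm}$ be the operad of the variety of Lie-admissible algebras. For a binary quadratic operad $P=P(E,R)$ with $E$ finite-dimensional, its Koszul dual operad is $P^{(!)}=P(E^\vee,R^\perp)$, where $E^\vee=E^*\otimes\mathrm{sgn}_2$ and $R^\perp$ is the orthogonal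 of $R$ with respect to the natural pairing between the arity-three components of the free operads on $E^\vee$ and on $E$. Proposition (Koszul dual of $\mathrm{di}\text{-}\mathrm{Com}^{\mathrm I}$). 1. The Koszul dual operad $\mathrm{di}\text{-}\mathrm{Com}^{\mathrm I\,(!)}$ is isomorphic, as a symmetric operad over $K$, to $\mathrm{LieAdm}$. 2. A $K$-algebra $U$ with one bilinear product is Lie-admissible if and only if, for every initial commutative dialgebra $S$ over $K$, the space $S\otimes_K U$ with the product $(a\otimes u)(b\otimes v)=(a\dashv b)\otimes uv$ is Lie-admissible. -/

import Mathlib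

open scoped TensorProduct

universe u v w

/-! ### Symmetric operads

A symmetric `K`-linear operad, in the coordinate-free form: `obj A` is the space of operations
whose inputs are labelled by the finite set `A`.  Restricting to `A = Fin n` gives the usual
`S_n`-modules `P(n)`; `comp` is the full composition `γ(x; (y_a)_a)`. -/

structure SymOperad (K : Type u) [Field K] where
  obj : (A : Type) → [Finite A] → Type u
  [addCommGroup : ∀ (A : Type) [Finite A], AddCommGroup (obj A)]
  [module : ∀ (A : Type) [Finite A], Module K (obj A)]
  /-- relabelling of the inputs -/
  map : ∀ {A B : Type} [Finite A] [Finite B], A ≃ B → (obj A →ₗ[K] obj B)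
  /-- the identity operation -/
  one : obj Unit
  /-- composition: plug the operation `y a` into the input `a` of `x` -/
  comp : ∀ {A : Type} {F : A → Type} [Finite A] [∀ a, Finite (F a)],
    obj A →ₗ[K] MultilinearMap K (fun a => obj (F a)) (obj (Σ a, F a))
  map_refl : ∀ {A : Type} [Finite A] (x : obj A), map (Equiv.refl A) x = x
  map_trans : ∀ {A B C : Type} [Finite A] [Finite B] [Finite C] (σ : A ≃ B) (ρ : B ≃ C)
    (x : obj A), map (σ.trans ρ) x = map ρ (map σ x)
  comp_map_left : ∀ {A B : Type} {F : B → Type} [Finite A] [Finite B] [∀ b, Finite (F b)]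
    (σ : A ≃ B) (x : obj A) (y : ∀ b, obj (F b)),
    comp (map σ x) y = map (Equiv.sigmaCongrLeft σ) (comp x (fun a => y (σ a)))
  comp_map_right : ∀ {A : Type} {F G : A → Type} [Finite A] [∀ a, Finite (F a)]
    [∀ a, Finite (G a)] (ρ : ∀ a, F a ≃ G a) (x : obj A) (y : ∀ a, obj (F a)),
    comp x (fun a => map (ρ a) (y a)) = map (Equiv.sigmaCongrRight ρ) (comp x y)
  one_comp : ∀ {F : Unit → Type} [∀ a, Finite (F a)] (y : ∀ a, obj (F a)),
    map (Equiv.uniqueSigma F) (comp one y) = y default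
  comp_one : ∀ {A : Type} [Finite A] (x : obj A),
    map (Equiv.sigmaUnique A (fun _ => Unit)) (comp x (fun _ => one)) = x
  comp_assoc : ∀ {A : Type} {F : A → Type} {G : ∀ a, F a → Type} [Finite A]
    [∀ a, Finite (F a)] [∀ a b, Finite (G a b)] (x : obj A) (y : ∀ a, obj (F a))
    (z : ∀ a b, obj (G a b)),
    map (Equiv.sigmaAssoc G) (comp (comp x y) (fun p : (Σ a, F a) => z p.1 p.2)) =
      comp x (fun a => comp (y a) (z a))

attribute [instance] SymOperad.addCommGroup SymOperad.module

/-- Isomorphisms of symmetric operads. -/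
structure SymOperad.Iso {K : Type u} [Field K] (P Q : SymOperad K) where
  equiv : ∀ (A : Type) [Finite A], P.obj A ≃ₗ[K] Q.obj A
  map_map : ∀ {A B : Type} [Finite A] [Finite B] (σ : A ≃ B) (x : P.obj A),
    equiv B (P.map σ x) = Q.map σ (equiv A x)
  map_one : equiv Unit P.one = Q.one
  map_comp : ∀ {A : Type} {F : A → Type} [Finite A] [∀ a, Finite (F a)] (x : P.obj A)
    (y : ∀ a, P.obj (F a)),
    equiv (Σ a, F a) (P.comp x y) = Q.comp (equiv A x) (fun a => equiv (F a) (y a))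

/-! ### Binary quadratic data and their Koszul duals -/

/-- The arity-three part `E⊗E ⊕ E⊗E ⊕ E⊗E` of the free operad on an `S₂`-module `E`: the
element `e ⊗ f` in the component `k` is the operation `(x_{k+1} f x_{k+2}) e x_k`
(indices modulo 3). -/
abbrev TernaryPart (K : Type u) [Field K] (E : Type u) [AddCommGroup E] [Module K E] : Type u :=
  Fin 3 → E ⊗[K] E

/-- The action of `S₃` on `TernaryPart K E` (renaming of the variables), where `τ` is the action of the
transposition on `E`: an odd permutation reverses the cyclic order of the three variables, so it
also interchanges the two arguments of the inner operation. -/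
noncomputable def TernaryPart.permute {K : Type u} [Field K] {E : Type u} [AddCommGroup E] [Module K E]
    (τ : E →ₗ[K] E) (σ : Equiv.Perm (Fin 3)) : TernaryPart K E →ₗ[K] TernaryPart K E :=
  LinearMap.pi fun k =>
    (if Equiv.Perm.sign σ = 1 then LinearMap.id else TensorProduct.map LinearMap.id τ) ∘ₗ
      LinearMap.proj (σ⁻¹ k)

/-- A finitely generated binary quadratic datum `(E, R)`: an `S₂`-module `E` of generating
operations (`τ` is the action of the transposition, `(τ e)(x, y) = e(y, x)`) and an
`S₃`-submodule `R` of relations in the arity-three part of the free operad on `E`. -/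
structure QuadraticData (K : Type u) [Field K] where
  E : Type u
  [addCommGroup : AddCommGroup E]
  [module : Module K E]
  [finite : Module.Finite K E]
  τ : E →ₗ[K] E
  τ_τ : ∀ e, τ (τ e) = e
  R : Submodule K (TernaryPart K E)
  R_stable : ∀ (σ : Equiv.Perm (Fin 3)) (t : TernaryPart K E), t ∈ R → TernaryPart.permute τ σ t ∈ R

attribute [instance] QuadraticData.addCommGroup QuadraticData.module QuadraticData.finite

/-- The pairing between the arity-three parts of the free operads on `E^∨` and on `E`:
`⟨α ⊗ β, e ⊗ f⟩ = α(e) β(f)` on equal components, and `0` on different components. -/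
noncomputable def TernaryPart.pairing {K : Type u} [Field K] {E : Type u} [AddCommGroup E] [Module K E]
    (α : TernaryPart K (Module.Dual K E)) (t : TernaryPart K E) : K :=
  ∑ k, TensorProduct.dualDistrib K E E (α k) (t k)

theorem TernaryPart.pairing_permute {K : Type u} [Field K] {E : Type u} [AddCommGroup E] [Module K E]
    (τ : E →ₗ[K] E) (σ : Equiv.Perm (Fin 3))
    (α : TernaryPart K (Module.Dual K E)) (t : TernaryPart K E) :
    TernaryPart.pairing (TernaryPart.permute (-τ.dualMap) σ α) t =
      ((Equiv.Perm.sign σ : ℤ) : K) * TernaryPart.pairing α (TernaryPart.permute τ σ⁻¹ t) := by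
  unfold TernaryPart.pairing
  rw [Finset.mul_sum, ← Equiv.sum_comp σ]
  refine Finset.sum_congr rfl fun k _ => ?_
  rcases Int.units_eq_one_or (Equiv.Perm.sign σ) with h | h
  · simp [TernaryPart.permute, h]
  · have h1 : ((-1 : ℤˣ) = 1) = False := by simp
    have h2 : Equiv.Perm.sign σ⁻¹ = -1 := by rw [Equiv.Perm.sign_inv, h]
    simp only [TernaryPart.permute, h2, h, h1, if_false, LinearMap.pi_apply,
      LinearMap.comp_apply, LinearMap.proj_apply, inv_inv,
      show σ⁻¹ (σ k) = k from σ.symm_apply_apply k]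
    generalize α k = a
    generalize t (σ k) = b
    induction a with
    | zero => simp
    | add a a' ha ha' => simp only [map_add, LinearMap.add_apply, ha, ha', mul_add]
    | tmul f g =>
      induction b with
      | zero => simp
      | add b b' hb hb' => simp only [map_add, hb, hb', mul_add]
      | tmul x y => simp

/-- The Koszul dual datum `(E^∨, R^⊥)`: `E^∨` is the dual of `E` twisted by the sign
representation, and `R^⊥` is the orthogonal of `R`. -/
noncomputable def QuadraticData.koszulDual {K : Type u} [Field K] (D : QuadraticData K) :
    QuadraticData K where
  E := Module.Dual K D.E
  τ := -D.τ.dualMap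
  τ_τ := fun e => by ext x; simp [D.τ_τ]
  R :=
    { carrier := {α | ∀ t ∈ D.R, TernaryPart.pairing α t = 0}
      add_mem' := fun {a b} ha hb t ht => by
        have h1 := ha t ht
        have h2 := hb t ht
        simp only [TernaryPart.pairing] at h1 h2 ⊢
        simp [Finset.sum_add_distrib, h1, h2]
      zero_mem' := fun t _ => by simp [TernaryPart.pairing]
      smul_mem' := fun c a ha t ht => by
        have h1 := ha t ht
        simp only [TernaryPart.pairing] at h1 ⊢
        simp [← Finset.mul_sum, h1] }
  R_stable := fun σ α hα t ht => by
    rw [TernaryPart.pairing_permute D.τ, hα _ (D.R_stable _ _ ht), mul_zero]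

/-! ### The variety of algebras and the operad of a binary quadratic datum -/

/-- The value of the operation `e ⊗ f ↦ (a f b) e c`. -/
noncomputable def nestedOp {K : Type u} [Field K] {E : Type u} [AddCommGroup E] [Module K E]
    {V : Type v} [AddCommGroup V] [Module K V] (op : E →ₗ[K] V →ₗ[K] V →ₗ[K] V) (a b c : V) :
    E ⊗[K] E →ₗ[K] V :=
  TensorProduct.lift (LinearMap.mk₂ K (fun e f => op e (op f a b) c)
    (by intros; simp) (by intros; simp) (by intros; simp) (by intros; simp))

/-- A structure of algebra of type `(E, R)` on `V`: the operations in `E` act on `V`, and the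
relations in `R` hold. -/
structure QuadraticData.AlgebraStr {K : Type u} [Field K] (D : QuadraticData K) (V : Type v)
    [AddCommGroup V] [Module K V] where
  op : D.E →ₗ[K] V →ₗ[K] V →ₗ[K] V
  op_τ : ∀ e a b, op (D.τ e) a b = op e b a
  op_R : ∀ t ∈ D.R, ∀ x : Fin 3 → V,
    ∑ k, nestedOp op (x (k + 1)) (x (k + 2)) (x k) (t k) = 0

/-- Nonassociative monomials in the variables `X`, with operations labelled by `E`. -/
inductive OpTree (E : Type u) (X : Type) : Type u
  | leaf (x : X) : OpTree E X
  | node (e : E) (l r : OpTree E X) : OpTree E X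

namespace OpTree

/-- The variables of a monomial, with multiplicity. -/
def leaves {E : Type u} {X : Type} : OpTree E X → Multiset X
  | leaf x => {x}
  | node _ l r => l.leaves + r.leaves

end OpTree

namespace QuadraticData

variable {K : Type u} [Field K] {D : QuadraticData K}

/-- The value of a monomial in an algebra of type `D`. -/
def AlgebraStr.evalTree {V : Type v} [AddCommGroup V] [Module K V] (S : D.AlgebraStr V) {X : Type}
    (x : X → V) : OpTree D.E X → V
  | .leaf i => x i
  | .node e l r => S.op e (S.evalTree x l) (S.evalTree x r)

/-- The value of a nonassociative polynomial in an algebra of type `D`. -/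
noncomputable def AlgebraStr.eval {V : Type v} [AddCommGroup V] [Module K V] (S : D.AlgebraStr V)
    {X : Type} (x : X → V) : (OpTree D.E X →₀ K) →ₗ[K] V :=
  Finsupp.linearCombination K (S.evalTree x)

variable (D) in
/-- The polynomial identities of the variety of algebras of type `D`. -/
def identities (X : Type) : Submodule K (OpTree D.E X →₀ K) where
  carrier := {f | ∀ (V : Type u) [AddCommGroup V] [Module K V] (S : D.AlgebraStr V) (x : X → V),
    S.eval x f = 0}
  add_mem' := fun ha hb V _ _ S x => by rw [map_add, ha V S x, hb V S x, add_zero]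
  zero_mem' := fun V _ _ S x => map_zero _
  smul_mem' := fun c f hf V _ _ S x => by rw [map_smul, hf V S x, smul_zero]

variable (D) in
/-- The free algebra on `X` in the variety of algebras of type `D`. -/
def Free (X : Type) : Type u := (OpTree D.E X →₀ K) ⧸ D.identities X

noncomputable instance (X : Type) : AddCommGroup (D.Free X) :=
  inferInstanceAs (AddCommGroup ((OpTree D.E X →₀ K) ⧸ D.identities X))

noncomputable instance (X : Type) : Module K (D.Free X) :=
  inferInstanceAs (Module K ((OpTree D.E X →₀ K) ⧸ D.identities X))

variable (D) in
/-- The class of a nonassociative polynomial in the free algebra. -/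
noncomputable def toFree (X : Type) : (OpTree D.E X →₀ K) →ₗ[K] D.Free X :=
  (D.identities X).mkQ

theorem toFree_surjective (X : Type) : Function.Surjective (D.toFree X) :=
  (D.identities X).mkQ_surjective

theorem toFree_eq_zero {X : Type} {f : OpTree D.E X →₀ K} :
    D.toFree X f = 0 ↔ f ∈ D.identities X :=
  Submodule.Quotient.mk_eq_zero _

/-- The class of a monomial in the free algebra. -/
noncomputable def mono {X : Type} (t : OpTree D.E X) : D.Free X :=
  D.toFree X (Finsupp.single t 1)

/-- The homomorphism from the free algebra that is given by the images of the variables. -/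
noncomputable def AlgebraStr.lift {V : Type u} [AddCommGroup V] [Module K V] (S : D.AlgebraStr V)
    {X : Type} (x : X → V) : D.Free X →ₗ[K] V :=
  (D.identities X).liftQ (S.eval x) (fun _ hf => hf V S x)

theorem AlgebraStr.lift_toFree {V : Type u} [AddCommGroup V] [Module K V] (S : D.AlgebraStr V)
    {X : Type} (x : X → V) (f : OpTree D.E X →₀ K) : S.lift x (D.toFree X f) = S.eval x f :=
  rfl

theorem AlgebraStr.lift_mono {V : Type u} [AddCommGroup V] [Module K V] (S : D.AlgebraStr V)
    {X : Type} (x : X → V) (t : OpTree D.E X) : S.lift x (mono t) = S.evalTree x t := by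
  simp [mono, AlgebraStr.lift_toFree, AlgebraStr.eval]

theorem free_ext {X : Type} {a b : D.Free X}
    (h : ∀ (V : Type u) [AddCommGroup V] [Module K V] (S : D.AlgebraStr V) (x : X → V),
      S.lift x a = S.lift x b) : a = b := by
  obtain ⟨f, rfl⟩ := toFree_surjective X a
  obtain ⟨g, rfl⟩ := toFree_surjective X b
  rw [← sub_eq_zero, ← map_sub, toFree_eq_zero]
  intro V _ _ S x
  rw [map_sub, sub_eq_zero]
  exact h V S x

theorem free_hom_ext {X : Type} {V : Type v} [AddCommGroup V] [Module K V]
    {f g : D.Free X →ₗ[K] V} (h : ∀ t, f (mono t) = g (mono t)) : f = g := by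
  have : f ∘ₗ D.toFree X = g ∘ₗ D.toFree X := by
    apply Finsupp.lhom_ext'
    intro t
    ext
    exact h t
  ext a
  obtain ⟨p, rfl⟩ := toFree_surjective X a
  exact LinearMap.congr_fun this p

/-- The operation `e` on nonassociative polynomials. -/
noncomputable def preOp {X : Type} (e : D.E) :
    (OpTree D.E X →₀ K) →ₗ[K] (OpTree D.E X →₀ K) →ₗ[K] (OpTree D.E X →₀ K) :=
  Finsupp.linearCombination K fun l =>
    Finsupp.linearCombination K fun r => Finsupp.single (OpTree.node e l r) 1

theorem AlgebraStr.eval_preOp {V : Type v} [AddCommGroup V] [Module K V] (S : D.AlgebraStr V)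
    {X : Type} (x : X → V) (e : D.E) (f g : OpTree D.E X →₀ K) :
    S.eval x (preOp e f g) = S.op e (S.eval x f) (S.eval x g) := by
  have : (preOp e).compr₂ (S.eval x) = (S.op e).compl₁₂ (S.eval x) (S.eval x) := by
    apply Finsupp.lhom_ext'
    intro l
    ext r
    simp [preOp, AlgebraStr.eval, AlgebraStr.evalTree]
  exact LinearMap.congr_fun₂ this f g

/-- The operation `e` on the free algebra. -/
noncomputable def freeOp {X : Type} (e : D.E) : D.Free X →ₗ[K] D.Free X →ₗ[K] D.Free X :=
  let F₁ : D.Free X →ₗ[K] (OpTree D.E X →₀ K) →ₗ[K] D.Free X :=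
    (D.identities X).liftQ ((preOp e).compr₂ (D.toFree X)) (fun f hf => by
      rw [LinearMap.mem_ker]
      refine LinearMap.ext fun g => toFree_eq_zero.2 fun V _ _ S x => ?_
      rw [S.eval_preOp, hf V S x, map_zero, LinearMap.zero_apply])
  LinearMap.flip ((D.identities X).liftQ F₁.flip (fun g hg => by
      rw [LinearMap.mem_ker]
      refine LinearMap.ext fun a => ?_
      obtain ⟨f, rfl⟩ := toFree_surjective X a
      refine toFree_eq_zero.2 fun V _ _ S x => ?_
      rw [S.eval_preOp, hg V S x, map_zero]))

theorem AlgebraStr.lift_freeOp {V : Type u} [AddCommGroup V] [Module K V] (S : D.AlgebraStr V)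
    {X : Type} (x : X → V) (e : D.E) (a b : D.Free X) :
    S.lift x (freeOp e a b) = S.op e (S.lift x a) (S.lift x b) := by
  obtain ⟨f, rfl⟩ := toFree_surjective X a
  obtain ⟨g, rfl⟩ := toFree_surjective X b
  exact S.eval_preOp x e f g

variable (D) in
/-- The free algebra is an algebra of type `D`. -/
noncomputable def freeStr (X : Type) : D.AlgebraStr (D.Free X) where
  op :=
    { toFun := freeOp
      map_add' := fun e e' => by
        refine LinearMap.ext fun a => LinearMap.ext fun b => free_ext fun V _ _ S x => ?_
        simp [S.lift_freeOp]
      map_smul' := fun c e => by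
        refine LinearMap.ext fun a => LinearMap.ext fun b => free_ext fun V _ _ S x => ?_
        simp [S.lift_freeOp] }
  op_τ := fun e a b => by
    refine free_ext fun V _ _ S x => ?_
    simp [S.lift_freeOp, S.op_τ]
  op_R := fun t ht y => by
    refine free_ext fun V _ _ S x => ?_
    rw [map_zero, ← S.op_R t ht (fun k => S.lift x (y k)), map_sum]
    refine Finset.sum_congr rfl fun k _ => ?_
    generalize t k = p
    induction p with
    | zero => simp
    | add p q hp hq => simp only [map_add, hp, hq]
    | tmul e f => simp [nestedOp, S.lift_freeOp]

theorem AlgebraStr.lift_op {V : Type u} [AddCommGroup V] [Module K V] (S : D.AlgebraStr V)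
    {X : Type} (x : X → V) (e : D.E) (a b : D.Free X) :
    S.lift x ((D.freeStr X).op e a b) = S.op e (S.lift x a) (S.lift x b) :=
  S.lift_freeOp x e a b

theorem mono_node {X : Type} (e : D.E) (l r : OpTree D.E X) :
    mono (.node e l r) = (D.freeStr X).op e (mono l) (mono r) := by
  apply free_ext
  intro V _ _ S x
  rw [S.lift_op, S.lift_mono, S.lift_mono, S.lift_mono]
  rfl

/-- The homomorphism of free algebras that substitutes the elements `y` for the variables. -/
noncomputable def subst {X Y : Type} (y : X → D.Free Y) : D.Free X →ₗ[K] D.Free Y :=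
  (D.freeStr Y).lift y

theorem subst_leaf {X Y : Type} (y : X → D.Free Y) (i : X) :
    subst y (mono (.leaf i)) = y i :=
  (D.freeStr Y).lift_mono y _

theorem subst_node {X Y : Type} (y : X → D.Free Y) (e : D.E) (l r : OpTree D.E X) :
    subst y (mono (.node e l r)) =
      (D.freeStr Y).op e (subst y (mono l)) (subst y (mono r)) := by
  rw [mono_node]
  exact (D.freeStr Y).lift_op y e _ _

theorem subst_subst {X Y Z : Type} (y : X → D.Free Y) (z : Y → D.Free Z) (a : D.Free X) :
    subst z (subst y a) = subst (fun i => subst z (y i)) a := by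
  rw [← LinearMap.comp_apply]
  congr 1
  apply free_hom_ext
  intro t
  induction t with
  | leaf i => simp [subst_leaf]
  | node e l r hl hr =>
    rw [LinearMap.comp_apply] at hl hr ⊢
    rw [subst_node, subst_node, ← hl, ← hr]
    exact (D.freeStr Z).lift_op z e _ _

theorem subst_id {X : Type} (a : D.Free X) : subst (fun i => mono (.leaf i)) a = a := by
  rw [← LinearMap.id_apply (R := K) (M := D.Free X) (subst _ a), ← LinearMap.comp_apply]
  conv_rhs => rw [← LinearMap.id_apply (R := K) a]
  congr 1
  apply free_hom_ext
  intro t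
  induction t with
  | leaf i => simp [subst_leaf]
  | node e l r hl hr =>
    simp only [LinearMap.comp_apply, LinearMap.id_apply] at hl hr ⊢
    rw [subst_node, hl, hr, mono_node]

/-- The homomorphism of free algebras that renames the variables. -/
noncomputable def rename {X Y : Type} (σ : X → Y) : D.Free X →ₗ[K] D.Free Y :=
  subst fun i => mono (.leaf (σ i))

variable (D) in
/-- The polynomials that are linear in each of the variables in `s` and involve no others. -/
noncomputable def multilinearOn {X : Type} (s : Set X) : Submodule K (D.Free X) :=
  Submodule.span K {a | ∃ t : OpTree D.E X, t.leaves.Nodup ∧ (∀ i, i ∈ t.leaves ↔ i ∈ s) ∧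
    a = mono t}

theorem op_mem_multilinearOn {X : Type} {s s' : Set X} (h : Disjoint s s') (e : D.E)
    {a b : D.Free X} (ha : a ∈ D.multilinearOn s) (hb : b ∈ D.multilinearOn s') :
    (D.freeStr X).op e a b ∈ D.multilinearOn (s ∪ s') := by
  induction ha using Submodule.span_induction with
  | zero => simp
  | add a a' _ _ h1 h2 => rw [map_add, LinearMap.add_apply]; exact add_mem h1 h2
  | smul c a _ h1 => rw [map_smul, LinearMap.smul_apply]; exact Submodule.smul_mem _ _ h1
  | mem a ha =>
    induction hb using Submodule.span_induction with
    | zero => simp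
    | add a a' _ _ h1 h2 => rw [map_add]; exact add_mem h1 h2
    | smul c a _ h1 => rw [map_smul]; exact Submodule.smul_mem _ _ h1
    | mem b hb =>
      obtain ⟨t, ht, hts, rfl⟩ := ha
      obtain ⟨t', ht', hts', rfl⟩ := hb
      refine Submodule.subset_span ⟨.node e t t', ?_, ?_, (mono_node _ _ _).symm⟩
      · refine Multiset.Nodup.add_iff ht ht' |>.2 ?_
        rw [Multiset.disjoint_left]
        intro i hi hi'
        exact Set.disjoint_left.1 h ((hts i).1 hi) ((hts' i).1 hi')
      · intro i
        simp [OpTree.leaves, hts, hts']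

theorem subst_mem_multilinearOn {X Y : Type} {f : X → Set Y}
    (hf : Pairwise fun i j => Disjoint (f i) (f j)) {y : X → D.Free Y}
    (hy : ∀ i, y i ∈ D.multilinearOn (f i)) {s : Set X} {a : D.Free X}
    (ha : a ∈ D.multilinearOn s) : subst y a ∈ D.multilinearOn (⋃ i ∈ s, f i) := by
  induction ha using Submodule.span_induction with
  | zero => simp
  | add a a' _ _ h1 h2 => rw [map_add]; exact add_mem h1 h2
  | smul c a _ h1 => rw [map_smul]; exact Submodule.smul_mem _ _ h1
  | mem a ha =>
    obtain ⟨t, ht, hts, rfl⟩ := ha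
    have hs : s = {i | i ∈ t.leaves} := by ext i; exact (hts i).symm
    subst hs
    clear hts
    induction t with
    | leaf i => simpa [subst_leaf, OpTree.leaves] using hy i
    | node e l r hl hr =>
      rw [subst_node]
      simp only [OpTree.leaves] at ht ⊢
      obtain ⟨h1, h2, h3⟩ := Multiset.nodup_add.1 ht
      have key := op_mem_multilinearOn ?_ e (hl h1) (hr h2)
      · convert key using 2
        ext j
        simp only [Set.mem_iUnion, Set.mem_ofPred_eq, Multiset.mem_add, Set.mem_union]
        grind
      · rw [Set.disjoint_left]
        intro j hj hj'
        simp only [Set.mem_iUnion, Set.mem_ofPred_eq] at hj hj'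
        obtain ⟨i, hi, hij⟩ := hj
        obtain ⟨i', hi', hij'⟩ := hj'
        have hne : i ≠ i' := fun h => Multiset.disjoint_left.1 h3 hi (h ▸ hi')
        exact Set.disjoint_left.1 (hf hne) hij hij'

variable (D) in
/-- The multilinear part of the free algebra on `A`: the span of the monomials in which each
element of `A` occurs exactly once. -/
noncomputable abbrev Multilin (A : Type) : Submodule K (D.Free A) := D.multilinearOn Set.univ

theorem leaf_mem_multilin : mono (.leaf ()) ∈ D.Multilin Unit :=
  Submodule.subset_span ⟨.leaf (), by simp [OpTree.leaves], by simp [OpTree.leaves], rfl⟩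

theorem rename_mem_multilinearOn {X Y : Type} {σ : X → Y} (hσ : Function.Injective σ) {s : Set X}
    {a : D.Free X} (ha : a ∈ D.multilinearOn s) : rename σ a ∈ D.multilinearOn (σ '' s) := by
  have := subst_mem_multilinearOn (f := fun i => {σ i}) (y := fun i => mono (.leaf (σ i))) ?_ ?_ ha
  · have h : σ '' s = ⋃ i ∈ s, {σ i} := by
      ext j
      simp [eq_comm]
    rw [h]
    exact this
  · intro i j hij
    simpa using fun h => hij (hσ h)
  · intro i
    exact Submodule.subset_span ⟨.leaf (σ i), by simp [OpTree.leaves], by simp [OpTree.leaves], rfl⟩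

/-- The substitution of polynomials in disjoint sets of variables. -/
noncomputable def plug {A : Type} {F : A → Type} (y : ∀ a, D.Free (F a)) :
    D.Free A →ₗ[K] D.Free (Σ a, F a) :=
  subst fun a => rename (Sigma.mk a) (y a)

theorem plug_mem_multilin {A : Type} {F : A → Type} {y : ∀ a, D.Free (F a)}
    (hy : ∀ a, y a ∈ D.Multilin (F a)) {x : D.Free A} (hx : x ∈ D.Multilin A) :
    plug y x ∈ D.Multilin (Σ a, F a) := by
  have := subst_mem_multilinearOn (f := fun a => Set.range (Sigma.mk (β := F) a))
    (y := fun a => rename (Sigma.mk a) (y a)) ?_ ?_ hx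
  · have h : (Set.univ : Set (Σ a, F a)) = ⋃ a ∈ (Set.univ : Set A), Set.range (Sigma.mk a) := by
      ext ⟨a, b⟩
      simp
    rw [Multilin, h]
    exact this
  · intro i j hij
    rw [Set.disjoint_left]
    rintro _ ⟨b, rfl⟩ ⟨c, hc⟩
    exact hij (congrArg Sigma.fst hc).symm
  · intro a
    rw [← Set.image_univ]
    exact rename_mem_multilinearOn sigma_mk_injective (hy a)

theorem plug_update_of_notMem {A : Type} [DecidableEq A] {F : A → Type} (y : ∀ a, D.Free (F a))
    (a : A) (p : D.Free (F a)) (t : OpTree D.E A) (ha : a ∉ t.leaves) :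
    plug (Function.update y a p) (mono t) = plug y (mono t) := by
  unfold plug
  induction t with
  | leaf i =>
    rw [subst_leaf, subst_leaf, Function.update_of_ne]
    rintro rfl
    simp [OpTree.leaves] at ha
  | node e l r hl hr =>
    simp only [OpTree.leaves, Multiset.mem_add, not_or] at ha
    rw [subst_node, subst_node, hl ha.1, hr ha.2]

theorem plug_update_linear {A : Type} [DecidableEq A] {F : A → Type} (y : ∀ a, D.Free (F a))
    (a : A) (c d : K) (p q : D.Free (F a)) (t : OpTree D.E A) (ht : t.leaves.Nodup)
    (ha : a ∈ t.leaves) :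
    plug (Function.update y a (c • p + d • q)) (mono t) =
      c • plug (Function.update y a p) (mono t) + d • plug (Function.update y a q) (mono t) := by
  induction t with
  | leaf i =>
    simp only [OpTree.leaves, Multiset.mem_singleton] at ha
    subst ha
    simp [plug, subst_leaf]
  | node e l r hl hr =>
    simp only [OpTree.leaves] at ht ha
    obtain ⟨h1, h2, h3⟩ := Multiset.nodup_add.1 ht
    have hn : ∀ p : D.Free (F a), plug (Function.update y a p) (mono (.node e l r)) =
        (D.freeStr _).op e (plug (Function.update y a p) (mono l))
          (plug (Function.update y a p) (mono r)) := fun p => subst_node _ _ _ _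
    rw [hn, hn, hn]
    rcases Multiset.mem_add.1 ha with h | h
    · have h' : a ∉ r.leaves := fun h' => Multiset.disjoint_left.1 h3 h h'
      simp only [hl h1 h, plug_update_of_notMem y a _ r h', map_add, map_smul,
        LinearMap.add_apply, LinearMap.smul_apply]
    · have h' : a ∉ l.leaves := fun h' => Multiset.disjoint_left.1 h3 h' h
      simp only [hr h2 h, plug_update_of_notMem y a _ l h', map_add, map_smul]

theorem plug_update_linear' {A : Type} [DecidableEq A] {F : A → Type} (y : ∀ a, D.Free (F a))
    (a : A) (c d : K) (p q : D.Free (F a)) {x : D.Free A} (hx : x ∈ D.Multilin A) :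
    plug (Function.update y a (c • p + d • q)) x =
      c • plug (Function.update y a p) x + d • plug (Function.update y a q) x := by
  induction hx using Submodule.span_induction with
  | zero => simp
  | add x x' _ _ h1 h2 => simp only [map_add, h1, h2]; module
  | smul k x _ h1 => simp only [map_smul, h1]; module
  | mem x hx =>
    obtain ⟨t, ht, hts, rfl⟩ := hx
    exact plug_update_linear y a c d p q t ht ((hts a).2 trivial)

theorem coe_update {A : Type} [DecidableEq A] {F : A → Type} (y : ∀ a, D.Multilin (F a)) (a : A)
    (p : D.Multilin (F a)) :
    (fun b => (Function.update y a p b).1) = Function.update (fun b => (y b).1) a p.1 := by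
  funext b
  rcases eq_or_ne b a with rfl | hb
  · simp
  · simp [hb]

theorem rename_subst {X Y Z : Type} (y : X → D.Free Y) (σ : Y → Z) (a : D.Free X) :
    rename σ (subst y a) = subst (fun i => rename σ (y i)) a :=
  subst_subst _ _ _

theorem subst_rename {X Y Z : Type} (σ : X → Y) (z : Y → D.Free Z) (a : D.Free X) :
    subst z (rename σ a) = subst (fun i => z (σ i)) a := by
  rw [rename, subst_subst]
  simp only [subst_leaf]

theorem rename_rename {X Y Z : Type} (σ : X → Y) (ρ : Y → Z) (a : D.Free X) :
    rename ρ (rename σ a) = rename (fun i => ρ (σ i)) a :=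
  subst_rename _ _ _

variable (D) in
/-- The operad of a binary quadratic datum, i.e. the operad of the corresponding variety:
its operations with inputs labelled by `A` are the multilinear elements of the free algebra
on `A`, and composition is substitution. -/
noncomputable def operad : SymOperad K where
  obj := fun A _ => D.Multilin A
  map := fun σ => (rename σ).restrict fun x hx => by
    have := rename_mem_multilinearOn σ.injective hx
    rwa [Set.image_univ_of_surjective σ.surjective] at this
  one := ⟨mono (.leaf ()), leaf_mem_multilin⟩
  comp := fun {A F} _ _ =>
    { toFun := fun x =>
        { toFun := fun y => ⟨plug (fun a => (y a).1) x.1,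
            plug_mem_multilin (fun a => (y a).2) x.2⟩
          map_update_add' := fun y a p q => by
            apply Subtype.ext
            have := plug_update_linear' (fun a => (y a).1) a 1 1 p.1 q.1 x.2
            simp only [one_smul, ← Submodule.coe_add, ← coe_update] at this
            exact this
          map_update_smul' := fun y a c p => by
            apply Subtype.ext
            have := plug_update_linear' (fun a => (y a).1) a c 0 p.1 0 x.2
            simp only [zero_smul, add_zero, ← Submodule.coe_smul, ← coe_update] at this
            exact this }
      map_add' := fun x x' => by
        ext y
        exact map_add (plug fun a => (y a).1) x.1 x'.1
      map_smul' := fun c x => by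
        ext y
        exact map_smul (plug fun a => (y a).1) c x.1 }
  map_refl := fun x => Subtype.ext (subst_id x.1)
  map_trans := fun σ ρ x => Subtype.ext (rename_rename σ ρ x.1).symm
  comp_map_left := fun {A B F} _ _ _ σ x y => by
    apply Subtype.ext
    change subst _ (rename σ x.1) = rename _ (subst _ x.1)
    rw [subst_rename, rename_subst]
    simp only [rename_rename]
    rfl
  comp_map_right := fun {A F G} _ _ _ ρ x y => by
    apply Subtype.ext
    change subst (fun a => rename _ (rename (ρ a) (y a).1)) x.1 = rename _ (subst _ x.1)
    rw [rename_subst]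
    simp only [rename_rename]
    rfl
  one_comp := fun {F} _ y => by
    apply Subtype.ext
    change rename (Equiv.uniqueSigma F) (subst _ (mono (.leaf ()))) = _
    rw [subst_leaf, rename_rename]
    exact subst_id _
  comp_one := fun {A} _ x => by
    apply Subtype.ext
    change rename _ (subst (fun a => rename _ (mono (.leaf ()))) x.1) = x.1
    rw [rename_subst]
    conv_rhs => rw [← subst_id x.1]
    congr 2
    funext a
    rw [rename_rename]
    exact subst_leaf _ _
  comp_assoc := fun {A F G} _ _ _ x y z => by
    apply Subtype.ext
    change rename _ (subst _ (subst _ x.1)) =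
      subst (fun a => rename _ (subst _ (y a).1)) x.1
    rw [subst_subst, rename_subst]
    congr 2
    funext a
    rw [subst_rename, rename_subst, rename_subst]
    simp only [rename_rename]
    rfl

end QuadraticData

/-! ### Varieties given by identities of degrees two and three -/

section Identities

variable (K : Type u) [Field K] (Ω : Type)

/-- The free `S₂`-module on a set `Ω` of binary operations: `single (ω, false) 1` is `x ω y`, and
`single (ω, true) 1` is `y ω x`. -/
abbrev BinaryPart : Type u := Ω × Bool →₀ K

/-- The interchange of the two variables. -/
noncomputable def BinaryPart.swap : BinaryPart K Ω →ₗ[K] BinaryPart K Ω :=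
  Finsupp.lmapDomain K K (Prod.map id not)

variable {Ω}

/-- The polynomial `x ω y`. -/
noncomputable def BinaryPart.gen (ω : Ω) : BinaryPart K Ω := Finsupp.single (ω, false) 1

variable {K}

/-- The polynomial `(x₀ p x₁) q x₂`. -/
noncomputable def TernaryPart.left (p q : BinaryPart K Ω) : TernaryPart K (BinaryPart K Ω) := Pi.single 2 (q ⊗ₜ p)

/-- The polynomial `x₀ p (x₁ q x₂) = (x₁ q x₂) p^{op} x₀`. -/
noncomputable def TernaryPart.right (p q : BinaryPart K Ω) : TernaryPart K (BinaryPart K Ω) :=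
  Pi.single 0 (BinaryPart.swap K Ω p ⊗ₜ q)

/-- The `S₂`-submodule that is generated by the polynomials `I₂` of degree two. -/
noncomputable def BinaryPart.relations (I₂ : Set (BinaryPart K Ω)) : Submodule K (BinaryPart K Ω) :=
  Submodule.span K (I₂ ∪ BinaryPart.swap K Ω '' I₂)

theorem BinaryPart.swap_swap (e : BinaryPart K Ω) : BinaryPart.swap K Ω (BinaryPart.swap K Ω e) = e := by
  induction e using Finsupp.induction_linear with
  | zero => simp
  | add f g hf hg => simp only [map_add, hf, hg]
  | single a b => simp [BinaryPart.swap, Prod.map]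

theorem BinaryPart.relations_le (I₂ : Set (BinaryPart K Ω)) :
    BinaryPart.relations I₂ ≤ (BinaryPart.relations I₂).comap (BinaryPart.swap K Ω) := by
  unfold BinaryPart.relations
  rw [Submodule.span_le]
  rintro e (he | ⟨e, he, rfl⟩)
  · exact Submodule.subset_span (Or.inr ⟨e, he, rfl⟩)
  · rw [SetLike.mem_coe, Submodule.mem_comap, BinaryPart.swap_swap]
    exact Submodule.subset_span (Or.inl he)

theorem TernaryPart.permute_permute {E : Type u} [AddCommGroup E] [Module K E] (τ : E →ₗ[K] E)
    (hτ : ∀ e, τ (τ e) = e) (σ ρ : Equiv.Perm (Fin 3)) (t : TernaryPart K E) :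
    TernaryPart.permute τ σ (TernaryPart.permute τ ρ t) = TernaryPart.permute τ (σ * ρ) t := by
  funext k
  have h1 : ((-1 : ℤˣ) = 1) = False := by simp
  have hττ : τ ∘ₗ τ = LinearMap.id := LinearMap.ext hτ
  rcases Int.units_eq_one_or (Equiv.Perm.sign σ) with h | h <;>
    rcases Int.units_eq_one_or (Equiv.Perm.sign ρ) with h' | h' <;>
    simp [TernaryPart.permute, h, h', ← LinearMap.comp_apply, ← TensorProduct.map_comp, hττ]

/-- The binary quadratic datum of the variety of algebras with the set `Ω` of binary operations
and with the defining identities `f = 0`, for `f` in `I₂` (multilinear of degree two) or in `I₃`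
(multilinear of degree three): `E` is the free `S₂`-module on `Ω` modulo `I₂`, and `R` is the
`S₃`-submodule that is generated by the image of `I₃`. -/
noncomputable def QuadraticData.ofIdentities [Finite Ω] (I₂ : Set (BinaryPart K Ω))
    (I₃ : Set (TernaryPart K (BinaryPart K Ω))) : QuadraticData K where
  E := BinaryPart K Ω ⧸ BinaryPart.relations I₂
  τ := (BinaryPart.relations I₂).mapQ _ (BinaryPart.swap K Ω) (BinaryPart.relations_le I₂)
  τ_τ := fun e => by
    obtain ⟨e, rfl⟩ := (BinaryPart.relations I₂).mkQ_surjective e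
    simp [BinaryPart.swap_swap]
  R := Submodule.span K
    {t | ∃ σ : Equiv.Perm (Fin 3), ∃ f ∈ I₃, t =
      TernaryPart.permute ((BinaryPart.relations I₂).mapQ _ (BinaryPart.swap K Ω) (BinaryPart.relations_le I₂)) σ
        (fun k => TensorProduct.map (BinaryPart.relations I₂).mkQ (BinaryPart.relations I₂).mkQ (f k))}
  R_stable := fun σ t ht => by
    induction ht using Submodule.span_induction with
    | zero => simp
    | add a a' _ _ h1 h2 => rw [map_add]; exact add_mem h1 h2
    | smul c a _ h1 => rw [map_smul]; exact Submodule.smul_mem _ _ h1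
    | mem t ht =>
      obtain ⟨ρ, f, hf, rfl⟩ := ht
      refine Submodule.subset_span ⟨σ * ρ, f, hf, ?_⟩
      refine TernaryPart.permute_permute _ (fun e => ?_) _ _ _
      obtain ⟨e, rfl⟩ := (BinaryPart.relations I₂).mkQ_surjective e
      simp [BinaryPart.swap_swap]

end Identities

/-! ### Initial commutative dialgebras and Lie-admissible algebras -/

/-- The two operations `⊣` and `⊢` of a dialgebra. -/
inductive DiOp : Type
  | dashv
  | vdash

instance : Finite DiOp :=
  Finite.of_injective (fun o : DiOp => match o with | .dashv => true | .vdash => false)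
    (by rintro (_ | _) (_ | _) h <;> simp_all)

/-- The binary quadratic datum of the variety of initial commutative dialgebras:
commutative dialgebras with the additional identity `(a ⊢ b) ⊢ c = a ⊣ (b ⊣ c)`. -/
noncomputable def diComI (K : Type u) [Field K] : QuadraticData K :=
  let l : BinaryPart K DiOp := BinaryPart.gen K DiOp.dashv
  let r : BinaryPart K DiOp := BinaryPart.gen K DiOp.vdash
  QuadraticData.ofIdentities
    -- `a ⊣ b = b ⊢ a`
    {l - BinaryPart.swap K DiOp r}
    { -- `a ⊣ (b ⊣ c) = a ⊣ (b ⊢ c)`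
      TernaryPart.right l l - TernaryPart.right l r,
      -- `(a ⊢ b) ⊢ c = (a ⊣ b) ⊢ c`
      TernaryPart.left r r - TernaryPart.left l r,
      -- `(a ⊣ b) ⊣ c = a ⊣ (b ⊣ c)`
      TernaryPart.left l l - TernaryPart.right l l,
      -- `(a ⊢ b) ⊣ c = a ⊢ (b ⊣ c)`
      TernaryPart.left r l - TernaryPart.right r l,
      -- `(a ⊢ b) ⊢ c = a ⊢ (b ⊢ c)`
      TernaryPart.left r r - TernaryPart.right r r,
      -- `(a ⊢ b) ⊢ c = a ⊣ (b ⊣ c)`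
      TernaryPart.left r r - TernaryPart.right l l }

/-- The binary quadratic datum of the variety of Lie-admissible algebras: one binary operation,
whose commutator `[x, y] = x y - y x` satisfies the Jacobi identity.  The component `k` of the
defining polynomial is `[[x_{k+1}, x_{k+2}], x_k]`. -/
noncomputable def lieAdm (K : Type u) [Field K] : QuadraticData K :=
  let μ : BinaryPart K Unit := BinaryPart.gen K ()
  let bracket : BinaryPart K Unit := μ - BinaryPart.swap K Unit μ
  QuadraticData.ofIdentities ∅ {fun _ => bracket ⊗ₜ bracket}

/-- `(S, ⊣, ⊢)` is an initial commutative dialgebra (`l a b = a ⊣ b` and `r a b = a ⊢ b`). -/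
structure IsInitialComDialgebra {K : Type u} [Field K] {S : Type v} [AddCommGroup S] [Module K S]
    (l r : S →ₗ[K] S →ₗ[K] S) : Prop where
  comm : ∀ a b, l a b = r b a
  zero_left : ∀ a b c, l a (l b c) = l a (r b c)
  zero_right : ∀ a b c, r (r a b) c = r (l a b) c
  assoc_left : ∀ a b c, l (l a b) c = l a (l b c)
  assoc_mid : ∀ a b c, l (r a b) c = r a (l b c)
  assoc_right : ∀ a b c, r (r a b) c = r a (r b c)
  initial : ∀ a b c, r (r a b) c = l a (l b c)

/-- The commutator of a bilinear product. -/
def productBracket {K : Type u} [Field K] {U : Type v} [AddCommGroup U] [Module K U]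
    (m : U →ₗ[K] U →ₗ[K] U) (a b : U) : U := m a b - m b a

/-- A bilinear product is Lie-admissible if its commutator satisfies the Jacobi identity. -/
def IsLieAdmissible {K : Type u} [Field K] {U : Type v} [AddCommGroup U] [Module K U]
    (m : U →ₗ[K] U →ₗ[K] U) : Prop :=
  ∀ a b c, productBracket m (productBracket m a b) c + productBracket m (productBracket m b c) a +
    productBracket m (productBracket m c a) b = 0

/-! Part 1 is an isomorphism of quadratic data. Since `x ⊢ y = y ⊣ x`, the space `E` of generating
operations of `diComI` has the basis `⊣` and its opposite, and the arity-three part has twelve basis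
monomials. The identities identify all twelve with one another, so an element of `R^⊥` takes the
same value on each of them: `R^⊥` is the line spanned by the all-ones functional
(`diComIDualRelation_mem`, `eq_smul_diComIDualRelation`). On each component this functional is `s ⊗
s`, where `s` is the sum of the two elements of the dual basis.

Because of the sign twist in `E^∨`, the transposition exchanges the dual basis vectors up to a minus
sign. Hence sending the dual of `⊣` to the product and the dual of its opposite to minus the
opposite product is equivariant. Under this map `s` becomes the commutator, and the generator of
`R^⊥` becomes the Jacobi polynomial. Mutually inverse homomorphisms of data act on monomials by
relabelling operations, hence give inverse morphisms of operads (`operadIso`).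

Part 2 rests on the same collapse. In an initial commutative dialgebra, `a ⊣ (b ⊣ c)` is symmetric
in its three arguments and equals `(a ⊣ b) ⊣ c`. A nested bracket of pure tensors is therefore this
element tensored with the nested bracket in `U`, and the Jacobi sum factors. Conversely, the ground
field is itself an initial commutative dialgebra, and tensoring with it returns `U`. -/

/-! ### Homomorphisms of binary quadratic data -/

namespace OpTree

/-- Relabelling of the operations of a monomial. -/
def mapOp {E : Type u} {E' : Type v} {X : Type} (φ : E → E') : OpTree E X → OpTree E' X
  | leaf x => leaf x
  | node e l r => node (φ e) (l.mapOp φ) (r.mapOp φ)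

theorem leaves_mapOp {E : Type u} {E' : Type v} {X : Type} (φ : E → E') (t : OpTree E X) :
    (t.mapOp φ).leaves = t.leaves := by
  induction t with
  | leaf x => rfl
  | node e l r hl hr => simp [mapOp, leaves, hl, hr]

theorem mapOp_mapOp {E : Type u} {E' : Type v} {E'' : Type w} {X : Type} (φ : E → E')
    (ψ : E' → E'') (t : OpTree E X) : (t.mapOp φ).mapOp ψ = t.mapOp (ψ ∘ φ) := by
  induction t with
  | leaf x => rfl
  | node e l r hl hr => simp [mapOp, hl, hr]

theorem mapOp_id {E : Type u} {X : Type} (t : OpTree E X) : t.mapOp id = t := by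
  induction t with
  | leaf x => rfl
  | node e l r hl hr => simp [mapOp, hl, hr]

end OpTree

/-- The map of arity-three parts that is induced by a map of the generating operations. -/
noncomputable def TernaryPart.mapOp {K : Type u} [Field K] {E E' : Type u} [AddCommGroup E]
    [Module K E] [AddCommGroup E'] [Module K E'] (φ : E →ₗ[K] E') :
    TernaryPart K E →ₗ[K] TernaryPart K E' :=
  LinearMap.pi fun k => TensorProduct.map φ φ ∘ₗ LinearMap.proj k

/-- An even permutation only moves components. An odd one also applies `τ` to the inner operation,
so equivariance of `φ` is what is needed. -/
theorem TernaryPart.mapOp_permute {K : Type u} [Field K] {E E' : Type u} [AddCommGroup E]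
    [Module K E] [AddCommGroup E'] [Module K E'] {φ : E →ₗ[K] E'} {τ : E →ₗ[K] E}
    {τ' : E' →ₗ[K] E'} (h : ∀ e, φ (τ e) = τ' (φ e)) (σ : Equiv.Perm (Fin 3))
    (t : TernaryPart K E) :
    mapOp φ (permute τ σ t) = permute τ' σ (mapOp φ t) := by
  have h' : φ ∘ₗ τ = τ' ∘ₗ φ := LinearMap.ext h
  have h1 : ((-1 : ℤˣ) = 1) = False := by simp
  funext k
  rcases Int.units_eq_one_or (Equiv.Perm.sign σ) with hs | hs
  · simp [mapOp, permute, hs]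
  · simp [mapOp, permute, hs, ← LinearMap.comp_apply, ← TensorProduct.map_comp, h']

namespace QuadraticData

variable {K : Type u} [Field K]

/-- Homomorphisms of binary quadratic data. -/
structure Hom (D D' : QuadraticData K) where
  toLin : D.E →ₗ[K] D'.E
  map_τ : ∀ e, toLin (D.τ e) = D'.τ (toLin e)
  map_R : ∀ t ∈ D.R, TernaryPart.mapOp toLin t ∈ D'.R

variable {D D' : QuadraticData K}

/-- Algebras of type `D'` are algebras of type `D`. -/
noncomputable def AlgebraStr.pullback {V : Type v} [AddCommGroup V] [Module K V]
    (S : D'.AlgebraStr V) (φ : Hom D D') : D.AlgebraStr V where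
  op := S.op ∘ₗ φ.toLin
  op_τ := fun e a b => by simp [φ.map_τ, S.op_τ]
  op_R := fun t ht x => by
    rw [← S.op_R _ (φ.map_R t ht) x]
    refine Finset.sum_congr rfl fun k _ => ?_
    simp only [TernaryPart.mapOp, LinearMap.pi_apply, LinearMap.comp_apply, LinearMap.proj_apply]
    generalize t k = p
    induction p with
    | zero => simp
    | add p q hp hq => simp only [map_add, hp, hq]
    | tmul e f => simp [nestedOp]

/-- The map of free algebras that is induced by a homomorphism of data. -/
noncomputable def Hom.mapFree (φ : Hom D D') (X : Type) : D.Free X →ₗ[K] D'.Free X :=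
  -- The universal property makes the map well defined: the free `D'`-algebra, viewed as a
  -- `D`-algebra along `φ`, satisfies all identities of `D`.
  ((D'.freeStr X).pullback φ).lift fun i => mono (.leaf i)

theorem Hom.mapFree_mono (φ : Hom D D') {X : Type} (t : OpTree D.E X) :
    φ.mapFree X (mono t) = mono (t.mapOp φ.toLin) := by
  rw [Hom.mapFree, AlgebraStr.lift_mono]
  induction t with
  | leaf i => rfl
  | node e l r hl hr =>
    rw [OpTree.mapOp, mono_node, ← hl, ← hr]
    rfl

/-- Both sides are homomorphisms in `a` that agree on variables. Operadic composition and
relabelling are substitutions, so this carries the compatibility of `operadIso` with both. -/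
theorem Hom.mapFree_subst (φ : Hom D D') {X Y : Type} (y : X → D.Free Y) (a : D.Free X) :
    φ.mapFree Y (subst y a) = subst (fun i => φ.mapFree Y (y i)) (φ.mapFree X a) := by
  rw [← LinearMap.comp_apply, ← LinearMap.comp_apply]
  congr 1
  apply free_hom_ext
  intro t
  simp only [LinearMap.comp_apply]
  induction t with
  | leaf i => rw [subst_leaf, mapFree_mono, OpTree.mapOp, subst_leaf]
  | node e l r hl hr =>
    rw [mapFree_mono] at hl hr ⊢
    rw [subst_node, OpTree.mapOp, subst_node, ← hl, ← hr]
    exact AlgebraStr.lift_op _ _ _ _ _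

theorem Hom.mapFree_rename (φ : Hom D D') {X Y : Type} (σ : X → Y) (a : D.Free X) :
    φ.mapFree Y (rename σ a) = rename σ (φ.mapFree X a) := by
  rw [rename, mapFree_subst]
  simp only [mapFree_mono, OpTree.mapOp]
  rfl

/-- Relabelling the operations of a monomial leaves its variables untouched. -/
theorem Hom.mapFree_mem_multilinearOn (φ : Hom D D') {X : Type} {s : Set X} {a : D.Free X}
    (ha : a ∈ D.multilinearOn s) : φ.mapFree X a ∈ D'.multilinearOn s := by
  induction ha using Submodule.span_induction with
  | zero => simp
  | add a a' _ _ h1 h2 => rw [map_add]; exact add_mem h1 h2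
  | smul c a _ h1 => rw [map_smul]; exact Submodule.smul_mem _ _ h1
  | mem a ha =>
    obtain ⟨t, ht, hts, rfl⟩ := ha
    refine Submodule.subset_span ⟨t.mapOp φ.toLin, ?_, ?_, φ.mapFree_mono t⟩
    · rwa [OpTree.leaves_mapOp]
    · rwa [OpTree.leaves_mapOp]

/-- On a monomial the composite relabels each operation by `ψ ∘ φ`, which is the identity. -/
theorem Hom.mapFree_mapFree (φ : Hom D D') (ψ : Hom D' D)
    (h : ∀ e, ψ.toLin (φ.toLin e) = e) {X : Type} (a : D.Free X) :
    ψ.mapFree X (φ.mapFree X a) = a := by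
  have h' : ψ.toLin ∘ φ.toLin = id := funext h
  have : ψ.mapFree X ∘ₗ φ.mapFree X = LinearMap.id := by
    apply free_hom_ext
    intro t
    simp [mapFree_mono, OpTree.mapOp_mapOp, h', OpTree.mapOp_id]
  exact LinearMap.congr_fun this a

/-- Isomorphic binary quadratic data have isomorphic operads. -/
noncomputable def operadIso (φ : Hom D D') (ψ : Hom D' D)
    (h : ∀ e, ψ.toLin (φ.toLin e) = e) (h' : ∀ e, φ.toLin (ψ.toLin e) = e) :
    SymOperad.Iso D.operad D'.operad where
  equiv := fun A _ =>
    LinearEquiv.ofLinearMap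
      (M := D.Multilin A) (M₂ := D'.Multilin A)
      ((φ.mapFree A).restrict fun _ => φ.mapFree_mem_multilinearOn)
      ((ψ.mapFree A).restrict fun _ => ψ.mapFree_mem_multilinearOn)
      (LinearMap.ext fun a => Subtype.ext (ψ.mapFree_mapFree φ h' a.1))
      (LinearMap.ext fun a => Subtype.ext (φ.mapFree_mapFree ψ h a.1))
  map_map := fun σ x => Subtype.ext (φ.mapFree_rename σ x.1)
  map_one := Subtype.ext (φ.mapFree_mono _)
  map_comp := fun {A F} _ _ x y => by
    apply Subtype.ext
    -- Composition is substitution of the `y a` with variables renamed into disjoint copies, so it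
    -- commutes with `mapFree` by the lemmas on `subst` and `rename`.
    change φ.mapFree _ (subst _ x.1) = subst (fun a => rename _ (φ.mapFree _ (y a).1)) _
    rw [φ.mapFree_subst]
    simp only [φ.mapFree_rename]
    rfl

end QuadraticData

/-! ### The Koszul dual of the datum of initial commutative dialgebras -/

/-- The pairing with `α` as a linear functional. -/
noncomputable def TernaryPart.pairingHom {K : Type u} [Field K] {E : Type u} [AddCommGroup E]
    [Module K E] (α : TernaryPart K (Module.Dual K E)) : TernaryPart K E →ₗ[K] K where
  toFun := pairing α
  map_add' := fun s t => by simp [pairing, Finset.sum_add_distrib]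
  map_smul' := fun c t => by simp [pairing, Finset.mul_sum]

/-- The projection of the free `S₂`-module on the operations to the generating operations. -/
noncomputable def QuadraticData.ofIdentitiesMk {K : Type u} [Field K] {Ω : Type} [Finite Ω]
    (I₂ : Set (BinaryPart K Ω)) (I₃ : Set (TernaryPart K (BinaryPart K Ω))) :
    BinaryPart K Ω →ₗ[K] (ofIdentities I₂ I₃).E :=
  (BinaryPart.relations I₂).mkQ

/-- A submodule contains the relations of `ofIdentities I₂ I₃` if and only if it contains the
images of the polynomials in `I₃` under all permutations of the variables. -/
theorem QuadraticData.ofIdentities_R_le_iff {K : Type u} [Field K] {Ω : Type} [Finite Ω]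
    {I₂ : Set (BinaryPart K Ω)} {I₃ : Set (TernaryPart K (BinaryPart K Ω))}
    {N : Submodule K (TernaryPart K (ofIdentities I₂ I₃).E)} :
    (ofIdentities I₂ I₃).R ≤ N ↔ ∀ f ∈ I₃, ∀ σ, TernaryPart.permute (ofIdentities I₂ I₃).τ σ
      (TernaryPart.mapOp (ofIdentitiesMk I₂ I₃) f) ∈ N := by
  refine Submodule.span_le.trans ⟨fun h f hf σ => h ⟨σ, f, hf, rfl⟩, ?_⟩
  rintro h _ ⟨σ, f, hf, rfl⟩
  exact h f hf σ

section DiComI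

variable (K : Type u) [Field K]

/-- The projection of the free `S₂`-module on `⊣, ⊢` to the generating operations. -/
noncomputable def diComIMk : BinaryPart K DiOp →ₗ[K] (diComI K).E :=
  QuadraticData.ofIdentitiesMk _ _

theorem diComIMk_surjective : Function.Surjective (diComIMk K) :=
  Submodule.mkQ_surjective _

/-- The operation `x ⊣ y`. -/
noncomputable def dashvOp : (diComI K).E := diComIMk K (Finsupp.single (DiOp.dashv, false) 1)

/-- The operation `y ⊣ x`. -/
noncomputable def dashvOpSwap : (diComI K).E := diComIMk K (Finsupp.single (DiOp.dashv, true) 1)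

theorem diComIMk_swap (e : BinaryPart K DiOp) :
    diComIMk K (BinaryPart.swap K DiOp e) = (diComI K).τ (diComIMk K e) :=
  rfl

/-- The transposed form of `x ⊣ y = y ⊢ x`; the companion statement for `true` is that relation
itself. -/
theorem diComIMk_vdash_false :
    diComIMk K (Finsupp.single (DiOp.vdash, false) 1) = dashvOpSwap K := by
  symm
  rw [← sub_eq_zero, dashvOpSwap, ← map_sub]
  refine (Submodule.Quotient.mk_eq_zero _).2 (Submodule.subset_span (Or.inr ⟨_, rfl, ?_⟩))
  rw [map_sub, BinaryPart.swap_swap]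
  simp [BinaryPart.swap, BinaryPart.gen, Prod.map]

theorem diComIMk_vdash_true :
    diComIMk K (Finsupp.single (DiOp.vdash, true) 1) = dashvOp K := by
  symm
  rw [← sub_eq_zero, dashvOp, ← map_sub]
  refine (Submodule.Quotient.mk_eq_zero _).2 (Submodule.subset_span (Or.inl ?_))
  simp [BinaryPart.swap, BinaryPart.gen, Prod.map]

theorem diComI_τ_dashvOp : (diComI K).τ (dashvOp K) = dashvOpSwap K := by
  rw [dashvOp, ← diComIMk_swap]
  simp [BinaryPart.swap, Prod.map, dashvOpSwap]

theorem diComI_τ_dashvOpSwap : (diComI K).τ (dashvOpSwap K) = dashvOp K := by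
  rw [← diComI_τ_dashvOp, (diComI K).τ_τ]

variable {K} in
/-- Linear maps on the generating operations are determined by the values on `⊣` and on its
opposite. -/
theorem diComI_hom_ext {V : Type v} [AddCommGroup V] [Module K V] {f g : (diComI K).E →ₗ[K] V}
    (h : f (dashvOp K) = g (dashvOp K)) (h' : f (dashvOpSwap K) = g (dashvOpSwap K)) : f = g := by
  rw [← LinearMap.cancel_right (diComIMk_surjective K)]
  apply Finsupp.lhom_ext'
  rintro ⟨_ | _, _ | _⟩ <;> ext
  · exact h
  · exact h'
  · simpa [diComIMk_vdash_false] using h'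
  · simpa [diComIMk_vdash_true] using h

/-- The functional with prescribed values on `⊣` and on its opposite. -/
noncomputable def diComIFunctional (a b : K) : Module.Dual K (diComI K).E :=
  Submodule.liftQ _
    -- The values on `⊢` are forced: `x ⊢ y` equals `y ⊣ x`, so `a` and `b` change places.
    (Finsupp.linearCombination K fun p : DiOp × Bool =>
      match p with
      | (.dashv, false) => a
      | (.dashv, true) => b
      | (.vdash, false) => b
      | (.vdash, true) => a)
    (by
      unfold BinaryPart.relations
      rw [Submodule.span_le]
      rintro _ (rfl | ⟨_, rfl, rfl⟩) <;> simp [BinaryPart.swap, BinaryPart.gen, Prod.map])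

theorem diComIFunctional_mk (a b : K) (e : BinaryPart K DiOp) :
    diComIFunctional K a b (diComIMk K e) = Finsupp.linearCombination K (fun p : DiOp × Bool =>
      match p with
      | (.dashv, false) => a
      | (.dashv, true) => b
      | (.vdash, false) => b
      | (.vdash, true) => a) e :=
  rfl

@[simp] theorem diComIFunctional_dashvOp (a b : K) : diComIFunctional K a b (dashvOp K) = a := by
  simp [dashvOp, diComIFunctional_mk]

@[simp] theorem diComIFunctional_dashvOpSwap (a b : K) :
    diComIFunctional K a b (dashvOpSwap K) = b := by
  simp [dashvOpSwap, diComIFunctional_mk]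

/-! ### The orthogonal of the relations -/

/-- The functional `e ⊗ f ↦ 1` for all basis operations `e`, `f`, on every component. -/
noncomputable def diComIDualRelation : TernaryPart K (Module.Dual K (diComI K).E) :=
  fun _ => diComIFunctional K 1 1 ⊗ₜ diComIFunctional K 1 1

/-- The functional is invariant under `S₃`, because its factors take equal values on `⊣` and its
opposite. So only the six identities themselves need checking, and each is a difference of two
monomials of value `1`. -/
theorem diComIDualRelation_mem : diComIDualRelation K ∈ (diComI K).koszulDual.R := by
  intro t ht
  have hτ : ∀ e, diComIFunctional K 1 1 ((diComI K).τ e) = diComIFunctional K 1 1 e := by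
    have : diComIFunctional K 1 1 ∘ₗ (diComI K).τ = diComIFunctional K 1 1 := by
      apply diComI_hom_ext <;> simp [diComI_τ_dashvOp, diComI_τ_dashvOpSwap]
    exact LinearMap.congr_fun this
  have hperm : ∀ σ (t : TernaryPart K (diComI K).E),
      TernaryPart.pairing (diComIDualRelation K) (TernaryPart.permute (diComI K).τ σ t) =
        TernaryPart.pairing (diComIDualRelation K) t := by
    intro σ t
    unfold TernaryPart.pairing
    rw [← Equiv.sum_comp σ]
    refine Finset.sum_congr rfl fun k _ => ?_
    simp only [TernaryPart.permute, LinearMap.pi_apply, LinearMap.comp_apply,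
      LinearMap.proj_apply, show σ⁻¹ (σ k) = k from σ.symm_apply_apply k]
    split_ifs
    · rfl
    · generalize t k = b
      induction b with
      | zero => simp
      | add b b' hb hb' => simp only [map_add, hb, hb']
      | tmul x y => simp [diComIDualRelation, hτ]
  refine (QuadraticData.ofIdentities_R_le_iff
    (N := LinearMap.ker (TernaryPart.pairingHom (diComIDualRelation K)))).2
    (fun f hf σ => (hperm σ _).trans ?_) ht
  change TernaryPart.pairing (diComIDualRelation K)
    (TernaryPart.mapOp (diComIMk K) f) = 0
  simp only [Set.mem_insert_iff, Set.mem_singleton_iff] at hf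
  rcases hf with rfl | rfl | rfl | rfl | rfl | rfl <;>
    simp [TernaryPart.pairing, Fin.sum_univ_three, TernaryPart.mapOp, TernaryPart.left,
      TernaryPart.right, diComIDualRelation, diComIFunctional_mk, BinaryPart.gen,
      BinaryPart.swap, Prod.map]

/-- Rotations of the three variables are even, so they shift components without inserting `τ`. -/
theorem TernaryPart.pairing_permute_addRight {E : Type u} [AddCommGroup E] [Module K E]
    (τ : E →ₗ[K] E) (α : TernaryPart K (Module.Dual K E)) (j : Fin 3) (t : TernaryPart K E) :
    TernaryPart.pairing α (TernaryPart.permute τ (Equiv.addRight j) t) =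
      ∑ k, TensorProduct.dualDistrib K E E (α (k + j)) (t k) := by
  have hs : Equiv.Perm.sign (Equiv.addRight j) = 1 := by
    fin_cases j <;> decide
  unfold TernaryPart.pairing
  rw [← Equiv.sum_comp (Equiv.addRight j)]
  refine Finset.sum_congr rfl fun k _ => ?_
  simp [TernaryPart.permute, hs]

variable {K} in
/-- The orthogonal of the relations is one-dimensional. -/
theorem eq_smul_diComIDualRelation {α : TernaryPart K (Module.Dual K (diComI K).E)}
    (hα : α ∈ (diComI K).koszulDual.R) : ∃ c : K, α = c • diComIDualRelation K := by
  let a (k : Fin 3) (e f : (diComI K).E) : K := TensorProduct.dualDistrib K _ _ (α k) (e ⊗ₜ f)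
  let L := dashvOp K
  let L' := dashvOpSwap K
  -- Orthogonality to each identity after rotation by `j`. Four of the six identities, with all
  -- rotations, already force the twelve values `a k e f` to coincide.
  have key (j : Fin 3) := fun f hf =>
    (TernaryPart.pairing_permute_addRight K (diComI K).τ α j
      (TernaryPart.mapOp (diComIMk K) f)).symm.trans
      (hα _ (QuadraticData.ofIdentities_R_le_iff.1 le_rfl f hf (Equiv.addRight j)))
  have hL : diComIMk K (Finsupp.single (DiOp.dashv, false) 1) = L := rfl
  have hL' : diComIMk K (Finsupp.single (DiOp.dashv, true) 1) = L' := rfl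
  have h1 (j : Fin 3) : a j L' L = a j L' L' := by
    have := key j _ (Or.inl rfl)
    simpa [Fin.sum_univ_three, TernaryPart.mapOp, TernaryPart.left, TernaryPart.right,
      BinaryPart.gen, BinaryPart.swap, Prod.map, diComIMk_vdash_false, diComIMk_vdash_true,
      hL, hL', sub_eq_zero] using this
  have h2 (j : Fin 3) : a (2 + j) L L = a j L' L := by
    have := key j _ (Or.inr (Or.inr (Or.inl rfl)))
    simpa [Fin.sum_univ_three, TernaryPart.mapOp, TernaryPart.left, TernaryPart.right,
      BinaryPart.gen, BinaryPart.swap, Prod.map, diComIMk_vdash_false, diComIMk_vdash_true,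
      hL, hL', sub_eq_zero] using this
  have h3 (j : Fin 3) : a (2 + j) L L' = a j L L := by
    have := key j _ (Or.inr (Or.inr (Or.inr (Or.inl rfl))))
    simpa [Fin.sum_univ_three, TernaryPart.mapOp, TernaryPart.left, TernaryPart.right,
      BinaryPart.gen, BinaryPart.swap, Prod.map, diComIMk_vdash_false, diComIMk_vdash_true,
      hL, hL', sub_eq_zero] using this
  have h4 (j : Fin 3) : a (2 + j) L' L' = a j L' L := by
    have := key j _ (Or.inr (Or.inr (Or.inr (Or.inr (Or.inr rfl)))))
    simpa [Fin.sum_univ_three, TernaryPart.mapOp, TernaryPart.left, TernaryPart.right,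
      BinaryPart.gen, BinaryPart.swap, Prod.map, diComIMk_vdash_false, diComIMk_vdash_true,
      hL, hL', sub_eq_zero] using this
  -- The identity `(a ⊢ b) ⊢ c = a ⊣ (b ⊣ c)`, used in `h4`, combines with `h1` to make the value on
  -- `L' ⊗ L'` the same on all components.
  have h5 (j : Fin 3) : a j L' L' = a 0 L' L' := by
    have e0 := (h4 0).trans (h1 0)
    have e1 := (h4 1).trans (h1 1)
    fin_cases j
    · rfl
    · exact e1.symm
    · exact e0
  have h6 (j : Fin 3) : a j L L = a 0 L' L' := by
    -- The shift by `1` undoes the `2 +` in `h2`, modulo `3`.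
    have := (h2 (j + 1)).trans ((h1 _).trans (h5 _))
    rwa [show 2 + (j + 1) = j by fin_cases j <;> rfl] at this
  have h7 (j : Fin 3) : a j L L' = a 0 L' L' := by
    have := (h3 (j + 1)).trans (h6 _)
    rwa [show 2 + (j + 1) = j by fin_cases j <;> rfl] at this
  refine ⟨a 0 L' L', funext fun k => ?_⟩
  -- As `E` is finite-dimensional, an element of `E^* ⊗ E^*` is determined by its values on `E ⊗ E`,
  -- hence on the four basis tensors.
  apply (TensorProduct.dualDistribEquiv (R := K) (M := (diComI K).E) (N := (diComI K).E)).injective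
  change TensorProduct.dualDistrib K _ _ (α k) =
    TensorProduct.dualDistrib K _ _ ((a 0 L' L' • diComIDualRelation K) k)
  apply TensorProduct.ext
  apply diComI_hom_ext <;> apply diComI_hom_ext
  · simpa [diComIDualRelation] using h6 k
  · simpa [diComIDualRelation] using h7 k
  · simpa [diComIDualRelation] using (h1 k).trans (h5 k)
  · simpa [diComIDualRelation] using h5 k

end DiComI

/-! ### The isomorphism with the datum of Lie-admissible algebras -/

section LieAdm

variable (K : Type u) [Field K]

/-- The projection of the free `S₂`-module on one operation to the generating operations. -/
noncomputable def lieAdmMk : BinaryPart K Unit →ₗ[K] (lieAdm K).E :=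
  QuadraticData.ofIdentitiesMk _ _

theorem lieAdmMk_surjective : Function.Surjective (lieAdmMk K) :=
  Submodule.mkQ_surjective _

theorem lieAdmMk_swap (e : BinaryPart K Unit) :
    lieAdmMk K (BinaryPart.swap K Unit e) = (lieAdm K).τ (lieAdmMk K e) :=
  rfl

/-- The product `x y`. -/
noncomputable def productOp : (lieAdm K).E := lieAdmMk K (Finsupp.single ((), false) 1)

/-- The opposite product `y x`. -/
noncomputable def productOpSwap : (lieAdm K).E := lieAdmMk K (Finsupp.single ((), true) 1)

theorem lieAdm_τ_productOp : (lieAdm K).τ (productOp K) = productOpSwap K := by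
  rw [productOp, ← lieAdmMk_swap]
  simp [BinaryPart.swap, Prod.map, productOpSwap]

theorem lieAdm_τ_productOpSwap : (lieAdm K).τ (productOpSwap K) = productOp K := by
  rw [← lieAdm_τ_productOp, (lieAdm K).τ_τ]

variable {K} in
/-- Linear maps on the generating operations are determined by the values on the product and on
its opposite. -/
theorem lieAdm_hom_ext {V : Type v} [AddCommGroup V] [Module K V] {f g : (lieAdm K).E →ₗ[K] V}
    (h : f (productOp K) = g (productOp K)) (h' : f (productOpSwap K) = g (productOpSwap K)) :
    f = g := by
  rw [← LinearMap.cancel_right (lieAdmMk_surjective K)]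
  apply Finsupp.lhom_ext'
  rintro ⟨_, _ | _⟩ <;> ext
  · exact h
  · exact h'

/-- The map of generating operations that sends the functionals dual to `⊣` and to its opposite to
the product and to minus the opposite product. -/
noncomputable def dualToLieAdm : Module.Dual K (diComI K).E →ₗ[K] (lieAdm K).E :=
  (LinearMap.applyₗ (dashvOp K)).smulRight (productOp K) -
    (LinearMap.applyₗ (dashvOpSwap K)).smulRight (productOpSwap K)

theorem dualToLieAdm_apply (α : Module.Dual K (diComI K).E) :
    dualToLieAdm K α = α (dashvOp K) • productOp K - α (dashvOpSwap K) • productOpSwap K :=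
  rfl

/-- The inverse of `dualToLieAdm`. -/
noncomputable def lieAdmToDual : (lieAdm K).E →ₗ[K] Module.Dual K (diComI K).E :=
  Submodule.liftQ _
    (Finsupp.linearCombination K fun p : Unit × Bool =>
      if p.2 then diComIFunctional K 0 (-1) else diComIFunctional K 1 0)
    (by simp [BinaryPart.relations])

theorem lieAdmToDual_mk (e : BinaryPart K Unit) :
    lieAdmToDual K (lieAdmMk K e) = Finsupp.linearCombination K (fun p : Unit × Bool =>
      if p.2 then diComIFunctional K 0 (-1) else diComIFunctional K 1 0) e :=
  rfl

@[simp] theorem lieAdmToDual_productOp :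
    lieAdmToDual K (productOp K) = diComIFunctional K 1 0 := by
  simp [productOp, lieAdmToDual_mk]

@[simp] theorem lieAdmToDual_productOpSwap :
    lieAdmToDual K (productOpSwap K) = diComIFunctional K 0 (-1) := by
  simp [productOpSwap, lieAdmToDual_mk]

theorem lieAdmToDual_dualToLieAdm (α : Module.Dual K (diComI K).E) :
    lieAdmToDual K (dualToLieAdm K α) = α := by
  apply diComI_hom_ext <;> simp [dualToLieAdm_apply]

theorem dualToLieAdm_lieAdmToDual (e : (lieAdm K).E) :
    dualToLieAdm K (lieAdmToDual K e) = e := by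
  have : dualToLieAdm K ∘ₗ lieAdmToDual K = LinearMap.id := by
    apply lieAdm_hom_ext <;> simp [dualToLieAdm_apply]
  exact LinearMap.congr_fun this e

/-- The minus sign on the opposite product in `dualToLieAdm` compensates for the sign twist in
`E^∨`. -/
theorem dualToLieAdm_τ (α : Module.Dual K (diComI K).E) :
    dualToLieAdm K ((diComI K).koszulDual.τ α) = (lieAdm K).τ (dualToLieAdm K α) := by
  change dualToLieAdm K (-(diComI K).τ.dualMap α) = _
  simp only [dualToLieAdm_apply, map_sub, map_smul, lieAdm_τ_productOp, lieAdm_τ_productOpSwap,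
    LinearMap.neg_apply, LinearMap.dualMap_apply, diComI_τ_dashvOp, diComI_τ_dashvOpSwap]
  module

theorem lieAdmToDual_τ (e : (lieAdm K).E) :
    lieAdmToDual K ((lieAdm K).τ e) = (diComI K).koszulDual.τ (lieAdmToDual K e) := by
  conv_lhs => rw [← dualToLieAdm_lieAdmToDual K e]
  rw [← dualToLieAdm_τ]
  exact lieAdmToDual_dualToLieAdm K _

/-! ### Matching the all-ones functional with the Jacobi identity -/

/-- The Jacobi polynomial of the commutator. -/
noncomputable def jacobiPolynomial : TernaryPart K (lieAdm K).E :=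
  fun _ => (productOp K - productOpSwap K) ⊗ₜ (productOp K - productOpSwap K)

theorem mapOp_lieAdmMk_bracket :
    TernaryPart.mapOp (lieAdmMk K) (fun _ =>
      (BinaryPart.gen K () - BinaryPart.swap K Unit (BinaryPart.gen K ())) ⊗ₜ
        (BinaryPart.gen K () - BinaryPart.swap K Unit (BinaryPart.gen K ()))) =
      jacobiPolynomial K := by
  have h : lieAdmMk K (BinaryPart.gen K ()) = productOp K := rfl
  funext k
  simp [TernaryPart.mapOp, jacobiPolynomial, lieAdmMk_swap, h, lieAdm_τ_productOp]

theorem jacobiPolynomial_mem : jacobiPolynomial K ∈ (lieAdm K).R := by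
  have := QuadraticData.ofIdentities_R_le_iff.1 (le_refl (lieAdm K).R) _ rfl 1
  change TernaryPart.permute (lieAdm K).τ 1 (TernaryPart.mapOp (lieAdmMk K) _) ∈ _ at this
  rw [mapOp_lieAdmMk_bracket] at this
  rwa [show TernaryPart.permute (lieAdm K).τ 1 (jacobiPolynomial K) = jacobiPolynomial K from
    funext fun k => by simp [TernaryPart.permute]] at this

/-- The functional with values `1, 1` goes to the commutator, so its tensor square on every
component gives the cyclic sum of nested commutators. -/
theorem mapOp_dualToLieAdm_diComIDualRelation :
    TernaryPart.mapOp (dualToLieAdm K) (diComIDualRelation K) = jacobiPolynomial K := by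
  funext k
  simp [TernaryPart.mapOp, diComIDualRelation, dualToLieAdm_apply, jacobiPolynomial]

theorem mapOp_lieAdmToDual_jacobiPolynomial :
    TernaryPart.mapOp (lieAdmToDual K) (jacobiPolynomial K) = diComIDualRelation K := by
  have h : diComIFunctional K 1 0 - diComIFunctional K 0 (-1) = diComIFunctional K 1 1 := by
    apply diComI_hom_ext <;> simp
  funext k
  simp [TernaryPart.mapOp, diComIDualRelation, jacobiPolynomial, h]

/-- `dualToLieAdm` as a homomorphism of data. -/
noncomputable def koszulDualHomLieAdm : QuadraticData.Hom (diComI K).koszulDual (lieAdm K) where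
  toLin := dualToLieAdm K
  map_τ := dualToLieAdm_τ K
  map_R := fun α hα => by
    obtain ⟨c, rfl⟩ := eq_smul_diComIDualRelation hα
    have := (lieAdm K).R.smul_mem c (jacobiPolynomial_mem K)
    rw [← mapOp_dualToLieAdm_diComIDualRelation, ← map_smul] at this
    exact this

/-- `lieAdmToDual` as a homomorphism of data. -/
noncomputable def lieAdmHomKoszulDual : QuadraticData.Hom (lieAdm K) (diComI K).koszulDual where
  toLin := lieAdmToDual K
  map_τ := lieAdmToDual_τ K
  -- By equivariance and the stability of `R^⊥`, the permuted Jacobi polynomials reduce to the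
  -- unpermuted one.
  map_R := (QuadraticData.ofIdentities_R_le_iff
    (N := (diComI K).koszulDual.R.comap (TernaryPart.mapOp (lieAdmToDual K)))).2 (by
      rintro _ rfl σ
      change TernaryPart.mapOp (lieAdmToDual K) (TernaryPart.permute (lieAdm K).τ σ
        (TernaryPart.mapOp (lieAdmMk K) _)) ∈ (diComI K).koszulDual.R
      rw [TernaryPart.mapOp_permute (lieAdmToDual_τ K), mapOp_lieAdmMk_bracket,
        mapOp_lieAdmToDual_jacobiPolynomial]
      exact (diComI K).koszulDual.R_stable _ _ (diComIDualRelation_mem K))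

end LieAdm

/-! ### Tensor products with initial commutative dialgebras -/

theorem productBracket_add_left {K : Type u} [Field K] {U : Type v} [AddCommGroup U] [Module K U]
    (m : U →ₗ[K] U →ₗ[K] U) (a a' b : U) :
    productBracket m (a + a') b = productBracket m a b + productBracket m a' b := by
  simp only [productBracket, map_add, LinearMap.add_apply]
  abel

theorem productBracket_add_right {K : Type u} [Field K] {U : Type v} [AddCommGroup U] [Module K U]
    (m : U →ₗ[K] U →ₗ[K] U) (a b b' : U) :
    productBracket m a (b + b') = productBracket m a b + productBracket m a b' := by
  simp only [productBracket, map_add, LinearMap.add_apply]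
  abel

/-- The Jacobi identity need only be checked on pure tensors. -/
theorem isLieAdmissible_of_tmul {K : Type u} [Field K] {S : Type w} {U : Type v} [AddCommGroup S]
    [Module K S] [AddCommGroup U] [Module K U]
    {m : S ⊗[K] U →ₗ[K] S ⊗[K] U →ₗ[K] S ⊗[K] U}
    (h : ∀ (a b c : S) (x y z : U),
      productBracket m (productBracket m (a ⊗ₜ x) (b ⊗ₜ y)) (c ⊗ₜ z) +
        productBracket m (productBracket m (b ⊗ₜ y) (c ⊗ₜ z)) (a ⊗ₜ x) +
        productBracket m (productBracket m (c ⊗ₜ z) (a ⊗ₜ x)) (b ⊗ₜ y) = 0) :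
    IsLieAdmissible m := by
  intro p q r
  induction p with
  | zero => simp [productBracket]
  | add p p' hp hp' =>
    simp only [productBracket_add_left, productBracket_add_right]
    -- Splitting `0` as `0 + 0` lets the two induction hypotheses replace the summands by Jacobi
    -- sums.
    rw [← add_zero (0 : S ⊗[K] U)]
    nth_rw 1 [← hp]
    rw [← hp']
    abel
  | tmul a x =>
    induction q with
    | zero => simp [productBracket]
    | add p p' hp hp' =>
      simp only [productBracket_add_left, productBracket_add_right]
      rw [← add_zero (0 : S ⊗[K] U)]
      nth_rw 1 [← hp]
      rw [← hp']
      abel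
    | tmul b y =>
      induction r with
      | zero => simp [productBracket]
      | add p p' hp hp' =>
        simp only [productBracket_add_left, productBracket_add_right]
        rw [← add_zero (0 : S ⊗[K] U)]
        nth_rw 1 [← hp]
        rw [← hp']
        abel
      | tmul c z => exact h a b c x y z

/-! ### Symmetry of triple products -/

namespace IsInitialComDialgebra

variable {K : Type u} [Field K] {S : Type w} [AddCommGroup S] [Module K S]
  {l r : S →ₗ[K] S →ₗ[K] S}

theorem mul_mul_swap_right (h : IsInitialComDialgebra l r) (a b c : S) :
    l a (l b c) = l a (l c b) := by
  rw [h.zero_left, ← h.comm]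

/-- The additional identity enters here: `c ⊣ (b ⊣ a) = (c ⊢ b) ⊢ a = a ⊣ (c ⊢ b) = a ⊣ (b ⊣ c)`.
With `mul_mul_swap_right` it generates the full symmetry under `S₃`. -/
theorem mul_mul_swap_ends (h : IsInitialComDialgebra l r) (a b c : S) :
    l c (l b a) = l a (l b c) := by
  rw [← h.initial, ← h.comm, ← h.comm]

theorem mul_mul_rotate (h : IsInitialComDialgebra l r) (a b c : S) :
    l b (l c a) = l a (l b c) := by
  rw [h.mul_mul_swap_ends, h.mul_mul_swap_right]

/-- All nested brackets of pure tensors have the same first factor. -/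
theorem productBracket_productBracket_tmul (h : IsInitialComDialgebra l r) {U : Type v}
    [AddCommGroup U] [Module K U] (m : U →ₗ[K] U →ₗ[K] U) (a b c : S) (x y z : U) :
    productBracket (TensorProduct.map₂ l m)
        (productBracket (TensorProduct.map₂ l m) (a ⊗ₜ x) (b ⊗ₜ y)) (c ⊗ₜ z) =
      l a (l b c) ⊗ₜ productBracket m (productBracket m x y) z := by
  -- Up to associativity, the four terms of the nested bracket have first factors `a(bc)`, `b(ac)`,
  -- `c(ab)` and `c(ba)`.
  have h1 : l c (l a b) = l a (l b c) :=
    (h.mul_mul_rotate b c a).trans (h.mul_mul_rotate a b c)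
  have h2 : l c (l b a) = l a (l b c) := h.mul_mul_swap_ends a b c
  have h3 : l b (l a c) = l a (l b c) := by
    rw [h.mul_mul_swap_right, h.mul_mul_rotate]
  simp only [productBracket, map_sub, LinearMap.sub_apply, TensorProduct.map₂_apply_tmul, TensorProduct.map_tmul,
    h.assoc_left, h1, h2, h3, TensorProduct.tmul_sub]

theorem isLieAdmissible_tensor (h : IsInitialComDialgebra l r) {U : Type v} [AddCommGroup U]
    [Module K U] {m : U →ₗ[K] U →ₗ[K] U} (hm : IsLieAdmissible m) :
    IsLieAdmissible (TensorProduct.map₂ l m) := by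
  refine isLieAdmissible_of_tmul fun a b c x y z => ?_
  have h1 : l b (l c a) = l a (l b c) := h.mul_mul_rotate a b c
  have h2 : l c (l a b) = l a (l b c) := (h.mul_mul_rotate b c a).trans h1
  simp only [h.productBracket_productBracket_tmul, h1, h2, ← TensorProduct.tmul_add, hm x y z,
    TensorProduct.tmul_zero]

end IsInitialComDialgebra

/-- A commutative associative algebra is an initial commutative dialgebra. -/
theorem isInitialComDialgebra_mul (K : Type u) [Field K] (A : Type w) [CommRing A] [Algebra K A] :
    IsInitialComDialgebra (LinearMap.mul K A) (LinearMap.mul K A) where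
  comm := fun a b => by simp [mul_comm]
  zero_left := fun a b c => rfl
  zero_right := fun a b c => rfl
  assoc_left := fun a b c => by simp [mul_assoc]
  assoc_mid := fun a b c => by simp [mul_assoc]
  assoc_right := fun a b c => by simp [mul_assoc]
  initial := fun a b c => by simp [mul_assoc]

theorem isLieAdmissible_iff_tensor (K : Type u) [Field K] (U : Type v) [AddCommGroup U]
    [Module K U] (m : U →ₗ[K] U →ₗ[K] U) :
    IsLieAdmissible m ↔
      ∀ (S : Type (max u w)) [AddCommGroup S] [Module K S] (l r : S →ₗ[K] S →ₗ[K] S),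
        IsInitialComDialgebra l r → IsLieAdmissible (TensorProduct.map₂ l m) := by
  refine ⟨fun hm S _ _ l r h => h.isLieAdmissible_tensor hm, fun H x y z => ?_⟩
  -- A copy of the ground field, lifted to the universe over which `S` ranges.
  have hK := isInitialComDialgebra_mul K (ULift.{w} K)
  have key := H (ULift.{w} K) _ _ hK (1 ⊗ₜ x) (1 ⊗ₜ y) (1 ⊗ₜ z)
  simp only [hK.productBracket_productBracket_tmul, ← TensorProduct.tmul_add] at key
  -- The identification of `K ⊗ U` with `U` sends `1 ⊗ u` to `u`, turning `key` into the Jacobi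
  -- identity in `U`.
  have := congrArg
    ((TensorProduct.lid K U).toLinearMap ∘ₗ
      TensorProduct.map (ULift.moduleEquiv (R := K) (M := K)).toLinearMap LinearMap.id) key
  simpa using this

theorem mainTheorem5 (K : Type u) [Field K] [CharZero K] :
    Nonempty (SymOperad.Iso (diComI K).koszulDual.operad (lieAdm K).operad) ∧
    ∀ (U : Type v) [AddCommGroup U] [Module K U] (m : U →ₗ[K] U →ₗ[K] U),
      IsLieAdmissible m ↔
        ∀ (S : Type (max u w)) [AddCommGroup S] [Module K S] (l r : S →ₗ[K] S →ₗ[K] S),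
          IsInitialComDialgebra l r → IsLieAdmissible (TensorProduct.map₂ l m) := by
  exact ⟨⟨QuadraticData.operadIso (koszulDualHomLieAdm K) (lieAdmHomKoszulDual K)
    (lieAdmToDual_dualToLieAdm K) (dualToLieAdm_lieAdmToDual K)⟩,
    fun U _ _ m => isLieAdmissible_iff_tensor K U m⟩
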